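/- Fix integers $p\ge 2$, $m\ge 1$ and real numbers $\delta>0$, $\mu_f,\mu_g$, $\nu_y\ge 0$, $\nu_f,\nu_g$ with $\nu_y\le\min(\nu_f,\nu_g)$, and $\nu\in\mathbb{R}$. All of the following objects may depend on an integer base $B\to\infty$, and $O(1)$, $O(\cdot)$, $\Theta(1)$ refer to (almost surely valid) bounds whose constants do not depend on $B$. **Inputs.** Let $\overline{\mathbf U}=[\overline{\mathbf U}_1,\dots,\overline{\mathbf U}_p]$ be a random real row vector and $\overline{\mathbf V}=[\overline{\mathbf V}_1,\dots,\overline{\mathbf V}_p]^T$ a random real column vector, each cut into $p$ blocks of length $m$, with entries that are $O(1)$. For $k=0,\dots,2p-2$ let $\overline{\mathbf X}_k$ be the coefficient of $\alpha^k$ in $\big(\sum_{j=1}^p\alpha^{j-1}\overline{\mathbf U}_j\big)\big(\sum_{j=1}^p\alpha^{p-j}\overline{\mathbf V}_j\big)$, so that $\overline{\mathbf X}_{p-1}=\overline{\mathbf U}\,\overline{\mathbf V}$. Assume that, for all large $B$, the scalars $\overline{\mathbf X}_0,\dots,\overline{\mathbf X}_{2p-2}$ are independent and that the joint differential entropy of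 every non-empty subset of them exceeds a constant $\Delta\in\mathbb{R}$ that does not depend on $B$. **Approximate MatDot code.** The evaluation points are $\alpha_i=B^{-\delta}\overline{\alpha_i}$, $i=1,\dots,p$, where $|\overline{\alpha_i}|=\Theta(1)$ and the $\overline{\alpha_i}$ are generic in the following sense: there is a constant $c>0$ such that, for all large $B$, $|\overline{\alpha_i}-\overline{\alpha_j}|\ge c$ for all $i\ne j$ and $|\overline{\alpha_1}+\dots+\overline{\alpha_p}|\ge c$. (If the $\overline{\alpha_i}$ do not depend on $B$, this says that they are distinct with a non-zero sum.) Say that $W$ represents $B^{\mu}x$ to precision $\nu_\bullet$ if $W$ is an integer multiple of $B^{\mu-\nu_\bullet}$ and $W=B^{\mu}(x+B^{-\nu_\bullet}\tilde w)$ with $\tilde w=O(1)$; the truncation $B^{\mu-\nu_\bullet}\lfloor B^{\nu_\bullet}x\rfloor$ is an example. Server $i$ receives vectors $\mathbf F_i$, $\mathbf G_i$ whose entries represent, to precision $\nu_f$ and $\nu_g$ respectively, the entries of $B^{\mu_f}\sum_{j}\alpha_i^{j-1}\overline{\mathbf U}_j$ and $B^{\mu_g}\sum_j\alpha_i^{p-j}\overline{\mathbf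 V}_j$. The user downloads from server $i$ a number $\mathbf Y_i$ that represents $\mathbf F_i\mathbf G_i$ to precision $\nu_y$ (with $\mu=\mu_f+\mu_g$). **Claim.** Suppose that some (possibly randomized) decoding rule, which may depend on $B$ and is applied to the $p$ answers $\mathbf Y_1,\dots,\mathbf Y_p$ only, produces $\mathbf{UV}$ with $$\mathbb{E}\,\big|\overline{\mathbf U}\,\overline{\mathbf V}-\mathbf{UV}\big|=O(B^{-\nu}).$$ Then $$\nu\le\min\big(\delta,\ (\nu_y-(p-1)\delta)^+\big)\qquad\text{and}\qquad \min(\nu_f,\nu_g)\ \ge\ p\,\nu .$$ -/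

import Mathlib

open MeasureTheory ProbabilityTheory Filter
open scoped ENNReal

namespace AMD

/-! ### MatDot encoding

`U = [U₀, …, U_{p-1}]` is a row and `V` a column, cut into `p` blocks of length `m` each, so that
the product `U V = ∑ j, U j ⬝ᵥ V j` is a scalar. Blocks are numbered from `0`. -/

/-- The (infinite precision) share `∑ a, αᵃ U_a` of a server with evaluation point `α`. -/
def shareF {p m : ℕ} (α : ℝ) (U : Fin p → Fin m → ℝ) : Fin m → ℝ :=
  ∑ a : Fin p, α ^ (a : ℕ) • U a

/-- The (infinite precision) share `∑ b, α^(p-1-b) V_b` of a server with evaluation point `α`. -/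
def shareG {p m : ℕ} (α : ℝ) (V : Fin p → Fin m → ℝ) : Fin m → ℝ :=
  ∑ b : Fin p, α ^ (p - 1 - (b : ℕ)) • V b

/-- The desired product `U V`. -/
def product {p m : ℕ} (U V : Fin p → Fin m → ℝ) : ℝ :=
  ∑ j : Fin p, U j ⬝ᵥ V j

/-- `X_k`, the coefficient of `αᵏ` in `shareF α U ⬝ᵥ shareG α V`. -/
def coeffX {p m : ℕ} (U V : Fin p → Fin m → ℝ) (k : ℕ) : ℝ :=
  ∑ a : Fin p, ∑ b : Fin p, if (a : ℕ) + (p - 1 - (b : ℕ)) = k then U a ⬝ᵥ V b else 0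

theorem shareF_dotProduct_shareG {p m : ℕ} (α : ℝ) (U V : Fin p → Fin m → ℝ) :
    shareF α U ⬝ᵥ shareG α V = ∑ k ∈ Finset.range (2 * p - 1), coeffX U V k * α ^ k := by
  have h : shareF α U ⬝ᵥ shareG α V = ∑ a : Fin p, ∑ b : Fin p,
      α ^ (a : ℕ) * (α ^ (p - 1 - (b : ℕ)) * (U a ⬝ᵥ V b)) := by
    simp only [shareF, shareG, sum_dotProduct, dotProduct_sum, smul_dotProduct,
      dotProduct_smul, smul_eq_mul, Finset.mul_sum]
    rw [Finset.sum_comm]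
    refine Finset.sum_congr rfl fun a _ => Finset.sum_congr rfl fun b _ => ?_
    ring
  rw [h]
  simp only [coeffX, Finset.sum_mul]
  symm
  rw [Finset.sum_comm]
  refine Finset.sum_congr rfl fun a _ => ?_
  rw [Finset.sum_comm]
  refine Finset.sum_congr rfl fun b _ => ?_
  have ha := a.isLt
  have hb := b.isLt
  rw [Finset.sum_eq_single ((a : ℕ) + (p - 1 - (b : ℕ)))]
  · rw [if_pos rfl, pow_add]
    ring
  · intro k _ hk
    rw [if_neg (Ne.symm hk), zero_mul]
  · intro h
    exact absurd (Finset.mem_range.2 (by omega)) h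

theorem coeffX_middle {p m : ℕ} (U V : Fin p → Fin m → ℝ) :
    coeffX U V (p - 1) = product U V := by
  unfold coeffX product
  refine Finset.sum_congr rfl fun a _ => ?_
  have ha := a.isLt
  rw [Finset.sum_eq_single a]
  · rw [if_pos (by omega)]
  · intro b _ hb
    have hb' := b.isLt
    exact if_neg fun h => hb (Fin.ext (by omega))
  · intro h
    exact absurd (Finset.mem_univ a) h

/-! ### Precision levels -/

/-- `W` represents `B^μ x` with `ν` digits of precision in base `B`: it is an integer multiple of
`B^(μ-ν)`, and `W = B^μ (x + B^(-ν) w)` with a noise term `|w| ≤ C`. -/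
def IsDigitRep (B μ ν C x W : ℝ) : Prop :=
  (∃ k : ℤ, W = B ^ (μ - ν) * k) ∧ ∃ w : ℝ, |w| ≤ C ∧ W = B ^ μ * (x + B ^ (-ν) * w)

/-- Truncation `B^(μ-ν) ⌊B^ν x⌋` is the basic example. -/
theorem isDigitRep_floor {B : ℝ} (hB : 0 < B) (μ ν x : ℝ) :
    IsDigitRep B μ ν 1 x (B ^ (μ - ν) * (⌊B ^ ν * x⌋ : ℝ)) := by
  refine ⟨⟨_, rfl⟩, (⌊B ^ ν * x⌋ : ℝ) - B ^ ν * x, ?_, ?_⟩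
  · rw [abs_le]
    constructor
    · linarith [Int.lt_floor_add_one (B ^ ν * x)]
    · linarith [Int.floor_le (B ^ ν * x)]
  · have h1 : B ^ (-ν) * B ^ ν = 1 := by rw [← Real.rpow_add hB]; simp
    have h2 : B ^ (μ - ν) = B ^ μ * B ^ (-ν) := by rw [← Real.rpow_add hB, sub_eq_add_neg]
    rw [h2]
    linear_combination (B ^ μ * x) * h1

/-! ### Evaluation points, and differential entropy -/

/-- `ᾱ_i = Θ(1)` as the base `B` tends to infinity. -/
def IsThetaOne {p : ℕ} (a : ℕ → Fin p → ℝ) : Prop :=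
  ∃ c C : ℝ, 0 < c ∧ ∀ᶠ B in atTop, ∀ i, c ≤ |a B i| ∧ |a B i| ≤ C

/-- Genericity of the normalized evaluation points, uniformly in the base `B`: they are separated
from each other, and their sum is separated from zero. For points that do not depend on `B` this
says that they are distinct and that their sum is not zero. -/
def IsGeneric {p : ℕ} (a : ℕ → Fin p → ℝ) : Prop :=
  ∃ c : ℝ, 0 < c ∧ ∀ᶠ B in atTop,
    (∀ i j, i ≠ j → c ≤ |a B i - a B j|) ∧ c ≤ |∑ i, a B i|

open Classical in
/-- Differential entropy `-∫ f log f` (in nats) of a probability law on `ℝ^ι` with density `f`, as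
the difference of the integrals of the positive and the negative part of `-f log f`;
it is `-∞` for a law without a density. -/
noncomputable def diffEntropy {ι : Type*} [Fintype ι] (P : Measure (ι → ℝ)) : EReal :=
  if P ≪ volume then
    ((∫⁻ x, ENNReal.ofReal (Real.negMulLog (P.rnDeriv volume x).toReal) : ℝ≥0∞) : EReal) -
      ((∫⁻ x, ENNReal.ofReal (-Real.negMulLog (P.rnDeriv volume x).toReal) : ℝ≥0∞) : EReal)
  else ⊥

end AMD

/-!
A decoder sees only the `p` answers, which are, up to noise of size `B^(-νy)`, the values
`∑ k, x_k α_iᵏ` of a polynomial with `2p - 1` coefficients. Suppose that a vector `d` of bounded norm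
changes these values by `O(B^(-νy))` only. On a segment `x + t d`, `0 ≤ t ≤ 1`, the answers lie in
the grid of spacing `B^(-νy)`, up to the common factor `B^(μf + μg)`, and within `O(B^(-νy))` of a
fixed point, so `O(1)` answers are possible, whatever the noise depends on. Each answer determines
the law of the guess of `x_{p-1}`, and a guess is accurate to `r` for a proportion `O(r / |d_{p-1}|)`
of the segment. Averaging over all segments in the direction `d`
(`setLIntegral_closedBall_le_of_line`, `setLIntegral_successBound_line_le`) bounds the Lebesgue
integral of the success probability by `O(r / |d_{p-1}|)`.

The law of the coefficients is not Lebesgue measure and its density need not be bounded, but its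
support is bounded and its joint entropy is bounded below; so `∫ f log f` is bounded, the densities
are uniformly integrable as `B` varies, and the expected success probability is small as well
(`lintegral_le_of_lt_diffEntropy`). By Markov's inequality a mean error `O(B^(-ν))` is success with
probability at least `1/2` at a radius `r = O(B^(-ν))`. Hence `ν ≤ γ` whenever
`|d_{p-1}| ≥ c B^(-γ)` (`exponent_le_of_direction`).

Two directions prove the bounds on `ν` (`exponent_le_min`). A multiple of the basis vector `e_{p-1}`
changes the answers by `B^(-(p-1)δ)` times its length, which gives `γ = (νy - (p-1)δ)⁺`. The
coefficients of `∏ l, (X - α_l)` do not change the answers at all, and the coefficient of `X^(p-1)`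
is `-B^(-δ) ∑ l, ᾱ_l`, which is where the non-zero sum enters; this gives `γ = δ`. The bound
`p ν ≤ min(νf, νg)` follows from `ν + (p-1) ν ≤ ν + (p-1) δ ≤ νy` if `ν > 0`, and is trivial
otherwise.
-/

namespace AMD

/-! ### Averaging along a direction -/

/-- By translation invariance, the integral over a ball may be averaged over the shifts `x + t d`
with `t ∈ [0, 1]`, at the price of a slightly larger ball; so a bound for all integrals along
segments in the direction `d` is a bound for the whole integral. -/
theorem setLIntegral_closedBall_le_of_line {ι : Type*} [Fintype ι] {φ : (ι → ℝ) → ℝ≥0∞}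
    (hφ : Measurable φ) {d : ι → ℝ} {R D : ℝ} (hd : ‖d‖ ≤ D) {ε : ℝ≥0∞}
    (h : ∀ x, ∫⁻ t in Set.Icc (0 : ℝ) 1, φ (x + t • d) ≤ ε) :
    ∫⁻ x in Metric.closedBall (0 : ι → ℝ) R, φ x
      ≤ ε * volume (Metric.closedBall (0 : ι → ℝ) (R + D)) := by
  have hshift : ∀ t ∈ Set.Icc (0 : ℝ) 1, ∫⁻ x in Metric.closedBall (0 : ι → ℝ) R, φ x
      ≤ ∫⁻ x in Metric.closedBall (0 : ι → ℝ) (R + D), φ (x + t • d) := by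
    intro t ht
    rw [← lintegral_indicator Metric.isClosed_closedBall.measurableSet,
      ← lintegral_indicator Metric.isClosed_closedBall.measurableSet,
      ← lintegral_add_right_eq_self _ (t • d)]
    refine lintegral_mono fun x => ?_
    by_cases hx : x + t • d ∈ Metric.closedBall (0 : ι → ℝ) R
    · have hx' : x ∈ Metric.closedBall (0 : ι → ℝ) (R + D) := by
        rw [mem_closedBall_zero_iff] at hx ⊢
        have h1 : ‖t • d‖ ≤ D := by
          rw [norm_smul, Real.norm_eq_abs, abs_of_nonneg ht.1]
          exact (mul_le_of_le_one_left (norm_nonneg _) ht.2).trans hd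
        calc ‖x‖ = ‖(x + t • d) - t • d‖ := by simp
          _ ≤ ‖x + t • d‖ + ‖t • d‖ := norm_sub_le _ _
          _ ≤ R + D := add_le_add hx h1
      simp [Set.indicator_of_mem hx, Set.indicator_of_mem hx']
    · simp [Set.indicator_of_notMem hx]
  calc ∫⁻ x in Metric.closedBall (0 : ι → ℝ) R, φ x
      = ∫⁻ _ in Set.Icc (0 : ℝ) 1, ∫⁻ x in Metric.closedBall (0 : ι → ℝ) R, φ x := by simp
    _ ≤ ∫⁻ t in Set.Icc (0 : ℝ) 1,
          ∫⁻ x in Metric.closedBall (0 : ι → ℝ) (R + D), φ (x + t • d) :=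
        setLIntegral_mono' measurableSet_Icc hshift
    _ = ∫⁻ x in Metric.closedBall (0 : ι → ℝ) (R + D),
          ∫⁻ t in Set.Icc (0 : ℝ) 1, φ (x + t • d) :=
        lintegral_lintegral_swap (by fun_prop)
    _ ≤ ∫⁻ _ in Metric.closedBall (0 : ι → ℝ) (R + D), ε := lintegral_mono fun x => h x
    _ = ε * volume (Metric.closedBall (0 : ι → ℝ) (R + D)) := by simp

theorem measurable_measure_closedBall (μ : Measure ℝ) [SFinite μ] (r : ℝ) :
    Measurable fun x : ℝ => μ (Metric.closedBall x r) := by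
  have hs : MeasurableSet {q : ℝ × ℝ | dist q.2 q.1 ≤ r} :=
    measurableSet_le (by fun_prop) measurable_const
  exact measurable_measure_prodMk_left hs

/-- A point moving with speed `|c|` spends, on average over the centre drawn from `μ`, time at most
`2 r / |c|` within distance `r` of it. -/
theorem lintegral_measure_closedBall_le (μ : Measure ℝ) [IsProbabilityMeasure μ] (a r : ℝ) {c : ℝ}
    (hc : c ≠ 0) :
    ∫⁻ t, μ (Metric.closedBall (a + t * c) r) ≤ ENNReal.ofReal (2 * (r / |c|)) := by
  have hs : MeasurableSet {q : ℝ × ℝ | dist q.2 (a + q.1 * c) ≤ r} :=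
    measurableSet_le (by fun_prop) measurable_const
  calc ∫⁻ t, μ (Metric.closedBall (a + t * c) r)
      = (volume.prod μ) {q : ℝ × ℝ | dist q.2 (a + q.1 * c) ≤ r} :=
        (Measure.prod_apply hs).symm
    _ = ∫⁻ u, volume (Metric.closedBall ((u - a) / c) (r / |c|)) ∂μ := by
        rw [Measure.prod_apply_symm hs]
        refine lintegral_congr fun u => congrArg _ (Set.ext fun t => ?_)
        have h1 : u - (a + t * c) = -(c * (t - (u - a) / c)) := by
          field_simp
          ring
        simp only [Set.mem_preimage, Set.mem_ofPred_eq, Metric.mem_closedBall, Real.dist_eq]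
        rw [h1, abs_neg, abs_mul, le_div_iff₀ (abs_pos.2 hc), mul_comm]
    _ ≤ ENNReal.ofReal (2 * (r / |c|)) := by simp [Real.volume_closedBall]

theorem card_Icc_ceil_floor_le (a : ℝ) {C : ℝ} (hC : 0 ≤ C) :
    ((Finset.Icc ⌈a - C⌉ ⌊a + C⌋).card : ℝ) ≤ 2 * C + 1 := by
  rw [Int.card_Icc]
  have h1 := Int.floor_le (a + C)
  have h2 := Int.le_ceil (a - C)
  have h3 : (((⌊a + C⌋ + 1 - ⌈a - C⌉).toNat : ℤ) : ℝ) = max (⌊a + C⌋ + 1 - ⌈a - C⌉ : ℝ) 0 := by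
    rw [Int.toNat_eq_max]
    push_cast
    rfl
  rw [← Int.cast_natCast, h3]
  exact max_le (by linarith) (by linarith)

/-! ### Success probability of a decoder along a direction -/

/-- An upper bound, depending on the input `x` only, for the probability that a decoder `κ` places
its guess within `r` of `x j`, when the answer `k` is an integer point with `|k i - L x i| ≤ C`:
the sum over all admissible answers. -/
noncomputable def successBound {ι n : Type*} (L : (ι → ℝ) → n → ℝ) (C : ℝ)
    (κ : (n → ℤ) → Measure ℝ) (j : ι) (r : ℝ) (x : ι → ℝ) : ℝ≥0∞ :=
  ∑' k : n → ℤ, {y : ι → ℝ | ∀ i, |(k i : ℝ) - L y i| ≤ C}.indicator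
    (fun y => κ k (Metric.closedBall (y j) r)) x

theorem measurable_successBound {ι n : Type*} [Finite n] {L : (ι → ℝ) → n → ℝ}
    (hL : Measurable L) (C : ℝ) (κ : (n → ℤ) → Measure ℝ) [∀ k, IsProbabilityMeasure (κ k)]
    (j : ι) (r : ℝ) : Measurable (successBound L C κ j r) := by
  refine Measurable.tsum fun k => Measurable.indicator ?_ ?_
  · exact (measurable_measure_closedBall (κ k) r).comp (measurable_pi_apply j)
  · rw [Set.ofPred_forall]
    refine MeasurableSet.iInter fun i => measurableSet_le ?_ measurable_const
    have := (measurable_pi_apply i).comp hL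
    exact (measurable_const.sub this).norm

theorem le_successBound {ι n : Type*} {L : (ι → ℝ) → n → ℝ} {C : ℝ}
    (κ : (n → ℤ) → Measure ℝ) (j : ι) (r : ℝ) {x : ι → ℝ} {k : n → ℤ}
    (hk : ∀ i, |(k i : ℝ) - L x i| ≤ C) :
    κ k (Metric.closedBall (x j) r) ≤ successBound L C κ j r x := by
  refine le_trans (le_of_eq ?_) (ENNReal.le_tsum k)
  rw [Set.indicator_of_mem (Set.mem_ofPred_eq ▸ hk)]

/-- While `x` moves along `d`, the vector `L x` moves by at most `C`. So only boundedly many answers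
are admissible on the segment, and each of them fixes a guess that is right for a time
`2 r / |d j|` at most. -/
theorem setLIntegral_successBound_line_le {ι n : Type*} [Fintype n]
    (L : (ι → ℝ) →ₗ[ℝ] n → ℝ) {C : ℝ} (hC : 0 ≤ C) (κ : (n → ℤ) → Measure ℝ)
    [∀ k, IsProbabilityMeasure (κ k)] {j : ι} (r : ℝ) {d : ι → ℝ} (hd : ∀ i, |L d i| ≤ C)
    (hdj : d j ≠ 0) (x : ι → ℝ) :
    ∫⁻ t in Set.Icc (0 : ℝ) 1, successBound L C κ j r (x + t • d)
      ≤ ENNReal.ofReal ((4 * C + 1) ^ Fintype.card n * (2 * (r / |d j|))) := by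
  classical
  set N : Finset (n → ℤ) := Fintype.piFinset fun i =>
    Finset.Icc ⌈L x i - 2 * C⌉ ⌊L x i + 2 * C⌋ with hN
  have hcard : (N.card : ℝ) ≤ (4 * C + 1) ^ Fintype.card n := by
    rw [hN, Fintype.card_piFinset, Nat.cast_prod, ← Finset.card_univ]
    rw [← Finset.prod_const]
    refine Finset.prod_le_prod (fun _ _ => by positivity) fun i _ => ?_
    have := card_Icc_ceil_floor_le (L x i) (C := 2 * C) (by linarith)
    linarith
  have hpt : ∀ t ∈ Set.Icc (0 : ℝ) 1, successBound L C κ j r (x + t • d)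
      ≤ ∑ k ∈ N, κ k (Metric.closedBall (x j + t * d j) r) := by
    intro t ht
    have hout : ∀ k ∉ N, {y : ι → ℝ | ∀ i, |(k i : ℝ) - L y i| ≤ C}.indicator
        (fun y => κ k (Metric.closedBall (y j) r)) (x + t • d) = 0 := by
      intro k hk
      refine Set.indicator_of_notMem (fun hk' => hk ?_) _
      rw [hN, Fintype.mem_piFinset]
      intro i
      have h1 := hk' i
      have h2 : |t * L d i| ≤ C := by
        rw [abs_mul, abs_of_nonneg ht.1]
        exact (mul_le_of_le_one_left (abs_nonneg _) ht.2).trans (hd i)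
      rw [map_add, map_smul, Pi.add_apply, Pi.smul_apply, smul_eq_mul] at h1
      rw [abs_le] at h1 h2
      rw [Finset.mem_Icc, Int.ceil_le, Int.le_floor]
      constructor <;> linarith [h1.1, h1.2, h2.1, h2.2]
    unfold successBound
    rw [tsum_eq_sum hout]
    refine Finset.sum_le_sum fun k _ => ?_
    refine (Set.indicator_le_self _ _ _).trans_eq ?_
    simp
  calc ∫⁻ t in Set.Icc (0 : ℝ) 1, successBound L C κ j r (x + t • d)
      ≤ ∫⁻ t in Set.Icc (0 : ℝ) 1, ∑ k ∈ N, κ k (Metric.closedBall (x j + t * d j) r) :=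
        setLIntegral_mono' measurableSet_Icc hpt
    _ ≤ ∫⁻ t, ∑ k ∈ N, κ k (Metric.closedBall (x j + t * d j) r) := setLIntegral_le_lintegral _ _
    _ = ∑ k ∈ N, ∫⁻ t, κ k (Metric.closedBall (x j + t * d j) r) :=
        lintegral_finsetSum _ fun k _ =>
          (measurable_measure_closedBall (κ k) r).comp (by fun_prop)
    _ ≤ ∑ k ∈ N, ENNReal.ofReal (2 * (r / |d j|)) :=
        Finset.sum_le_sum fun k _ => lintegral_measure_closedBall_le (κ k) _ _ hdj
    _ = ENNReal.ofReal N.card * ENNReal.ofReal (2 * (r / |d j|)) := by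
        rw [Finset.sum_const, nsmul_eq_mul, ENNReal.ofReal_natCast]
    _ ≤ ENNReal.ofReal ((4 * C + 1) ^ Fintype.card n) * ENNReal.ofReal (2 * (r / |d j|)) := by
        gcongr
    _ = _ := (ENNReal.ofReal_mul (by positivity)).symm

/-! ### Laws of bounded support with entropy bounded below -/

/-- For a law carried by `s` the positive part of `-f log f` has integral at most `volume s`, so a
lower bound on the entropy bounds the integral of the negative part. -/
theorem lintegral_negPart_le_of_lt_diffEntropy {ι : Type*} [Fintype ι] {μ : Measure (ι → ℝ)}
    [IsProbabilityMeasure μ] {Δ : ℝ} (h : (Δ : EReal) < diffEntropy μ) {s : Set (ι → ℝ)}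
    (hs : MeasurableSet s) (hμs : μ sᶜ = 0) :
    μ ≪ volume ∧ (∀ᵐ x ∂volume, x ∉ s → μ.rnDeriv volume x = 0) ∧
      ∫⁻ x, ENNReal.ofReal (-Real.negMulLog (μ.rnDeriv volume x).toReal)
        ≤ volume s + ENNReal.ofReal (-Δ) := by
  unfold diffEntropy at h
  split_ifs at h with hac
  swap
  · exact absurd h not_lt_bot
  have hzero : ∀ᵐ x ∂volume, x ∉ s → μ.rnDeriv volume x = 0 := by
    have h1 : ∫⁻ x in sᶜ, μ.rnDeriv volume x = 0 := by
      rw [Measure.setLIntegral_rnDeriv hac, hμs]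
    rw [setLIntegral_eq_zero_iff hs.compl (Measure.measurable_rnDeriv μ volume)] at h1
    exact h1
  refine ⟨hac, hzero, ?_⟩
  have hpos : ∫⁻ x, ENNReal.ofReal (Real.negMulLog (μ.rnDeriv volume x).toReal) ≤ volume s := by
    rw [← setLIntegral_one s, ← lintegral_indicator hs]
    refine lintegral_mono_ae ?_
    filter_upwards [hzero] with x hx
    by_cases hxs : x ∈ s
    · rw [Set.indicator_of_mem hxs, ← ENNReal.ofReal_one]
      refine ENNReal.ofReal_le_ofReal ?_
      have h1 := Real.negMulLog_le_one_sub_self (x := (μ.rnDeriv volume x).toReal)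
        ENNReal.toReal_nonneg
      linarith [ENNReal.toReal_nonneg (a := μ.rnDeriv volume x)]
    · simp [hx hxs]
  set a := ∫⁻ x, ENNReal.ofReal (Real.negMulLog (μ.rnDeriv volume x).toReal)
  set b := ∫⁻ x, ENNReal.ofReal (-Real.negMulLog (μ.rnDeriv volume x).toReal)
  refine le_trans ?_ (add_le_add_left hpos _)
  rcases eq_or_ne a ⊤ with ha | ha
  · simp [ha]
  rcases eq_or_ne b ⊤ with hb | hb
  · -- in `EReal` the difference `a - ⊤` is `⊥`
    rw [hb, EReal.coe_ennreal_top, EReal.sub_top] at h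
    exact absurd h not_lt_bot
  rw [← EReal.coe_ennreal_toReal ha, ← EReal.coe_ennreal_toReal hb, ← EReal.coe_sub,
    EReal.coe_lt_coe_iff] at h
  rw [← ENNReal.ofReal_toReal ha, ← ENNReal.ofReal_toReal hb]
  refine le_trans (ENNReal.ofReal_le_ofReal ?_) ENNReal.ofReal_add_le
  linarith

/-- Quantitative uniform integrability: among laws carried by `s` whose entropy exceeds `Δ`, a test
function `0 ≤ φ ≤ 1` of small Lebesgue integral has small expectation. Where the density `f` exceeds
`T`, it is bounded by `f log f / log T`. -/
theorem lintegral_le_of_lt_diffEntropy {ι : Type*} [Fintype ι] {μ : Measure (ι → ℝ)}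
    [IsProbabilityMeasure μ] {Δ : ℝ} (h : (Δ : EReal) < diffEntropy μ) {s : Set (ι → ℝ)}
    (hs : MeasurableSet s) (hμs : μ sᶜ = 0) {φ : (ι → ℝ) → ℝ≥0∞} (hφ : Measurable φ)
    (hφ1 : ∀ x, φ x ≤ 1) {T : ℝ} (hT : 1 < T) :
    ∫⁻ x, φ x ∂μ ≤ ENNReal.ofReal T * (∫⁻ x in s, φ x)
      + ENNReal.ofReal (1 / Real.log T) * (volume s + ENNReal.ofReal (-Δ)) := by
  obtain ⟨hac, hzero, hneg⟩ := lintegral_negPart_le_of_lt_diffEntropy h hs hμs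
  have hlog : 0 < Real.log T := Real.log_pos hT
  calc ∫⁻ x, φ x ∂μ = ∫⁻ x, φ x ∂(volume.withDensity (μ.rnDeriv volume)) := by
        rw [Measure.withDensity_rnDeriv_eq μ volume hac]
    _ = ∫⁻ x, μ.rnDeriv volume x * φ x := by
        rw [lintegral_withDensity_eq_lintegral_mul _ (Measure.measurable_rnDeriv μ volume) hφ]
        rfl
    _ ≤ ∫⁻ x, (ENNReal.ofReal T * s.indicator φ x + ENNReal.ofReal (1 / Real.log T) *
          ENNReal.ofReal (-Real.negMulLog (μ.rnDeriv volume x).toReal)) := by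
        refine lintegral_mono_ae ?_
        filter_upwards [hzero, Measure.rnDeriv_ne_top μ volume] with x hx hfin
        by_cases hxs : x ∈ s
        swap
        · simp [hx hxs]
        rw [Set.indicator_of_mem hxs]
        rcases le_or_gt (μ.rnDeriv volume x).toReal T with hle | hgt
        · refine le_add_right (mul_le_mul_left ?_ _)
          exact (ENNReal.le_ofReal_iff_toReal_le hfin (by linarith)).2 hle
        · refine le_add_left ((mul_le_mul_right (hφ1 x) _).trans ?_)
          rw [mul_one, ← ENNReal.ofReal_mul (by positivity),
            ENNReal.le_ofReal_iff_toReal_le hfin]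
          · have h1 : Real.log T ≤ Real.log (μ.rnDeriv volume x).toReal :=
              Real.log_le_log (by linarith) hgt.le
            rw [Real.negMulLog, neg_mul, neg_neg, one_div, ← div_eq_inv_mul, le_div_iff₀ hlog]
            exact mul_le_mul_of_nonneg_left h1 ENNReal.toReal_nonneg
          · have h1 : 0 ≤ Real.log (μ.rnDeriv volume x).toReal := Real.log_nonneg (by linarith)
            rw [Real.negMulLog, neg_mul, neg_neg]
            have := ENNReal.toReal_nonneg (a := μ.rnDeriv volume x)
            positivity
    _ = ENNReal.ofReal T * (∫⁻ x in s, φ x) + ENNReal.ofReal (1 / Real.log T) *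
          ∫⁻ x, ENNReal.ofReal (-Real.negMulLog (μ.rnDeriv volume x).toReal) := by
        rw [lintegral_add_left ((hφ.indicator hs).const_mul _),
          lintegral_const_mul _ (hφ.indicator hs), lintegral_indicator hs,
          lintegral_const_mul' _ _ ENNReal.ofReal_ne_top]
    _ ≤ _ := by gcongr

/-! ### Decoding accuracy against an almost invisible direction -/

/-- The law of `X` has entropy above `Δ`, the answer is an integer point close to `L (X ω)`, and the
decoder guesses `X ω j` from the answer. The success probability at radius `r` is small if `L d` is
bounded and `|d j|` is large compared with `r`, while the failure probability is at most the mean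
error divided by `r`. Here `η ω` is the law of the guess. -/
theorem one_le_of_line {Ω ι n : Type*} [MeasurableSpace Ω] {P : Measure Ω}
    [IsProbabilityMeasure P] [Fintype ι] [Fintype n] {X : Ω → ι → ℝ} (hX : Measurable X) {R : ℝ}
    (hR : ∀ᵐ ω ∂P, ‖X ω‖ ≤ R) {Δ : ℝ} (hΔ : (Δ : EReal) < diffEntropy (P.map X))
    (L : (ι → ℝ) →ₗ[ℝ] n → ℝ) {C : ℝ} (hC : 0 ≤ C) (κ : (n → ℤ) → Measure ℝ)
    [∀ k, IsProbabilityMeasure (κ k)] {η : Ω → Measure ℝ}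
    (hη : ∀ᵐ ω ∂P, ∃ k : n → ℤ, (∀ i, |(k i : ℝ) - L (X ω) i| ≤ C) ∧ η ω = κ k)
    {j : ι} {d : ι → ℝ} {D : ℝ} (hdD : ‖d‖ ≤ D) (hLd : ∀ i, |L d i| ≤ C) (hdj : d j ≠ 0)
    {r : ℝ} (hr : 0 < r) {T : ℝ} (hT : 1 < T) :
    1 ≤ ENNReal.ofReal T * (ENNReal.ofReal ((4 * C + 1) ^ Fintype.card n * (2 * (r / |d j|)))
          * volume (Metric.closedBall (0 : ι → ℝ) (R + D)))
        + ENNReal.ofReal (1 / Real.log T) *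
          (volume (Metric.closedBall (0 : ι → ℝ) R) + ENNReal.ofReal (-Δ))
        + (∫⁻ ω, ∫⁻ u, ENNReal.ofReal |X ω j - u| ∂(η ω) ∂P) / ENNReal.ofReal r := by
  set φ := successBound L C κ j r with hφ
  have hφm : Measurable φ :=
    measurable_successBound (LinearMap.continuous_of_finiteDimensional L).measurable C κ j r
  have hψm : Measurable fun x => min (φ x) 1 := hφm.min measurable_const
  have hμ : IsProbabilityMeasure (P.map X) := Measure.isProbabilityMeasure_map hX.aemeasurable
  have hball : MeasurableSet (Metric.closedBall (0 : ι → ℝ) R) :=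
    Metric.isClosed_closedBall.measurableSet
  have hsupp : P.map X (Metric.closedBall (0 : ι → ℝ) R)ᶜ = 0 := by
    rw [Measure.map_apply hX hball.compl]
    refine measure_mono_null (fun ω hω => ?_) hR
    simpa using hω
  -- Markov's inequality, for each input separately
  have hmarkov : ∀ᵐ ω ∂P, 1 ≤ min (φ (X ω)) 1
      + (∫⁻ u, ENNReal.ofReal |X ω j - u| ∂(η ω)) / ENNReal.ofReal r := by
    filter_upwards [hη] with ω ⟨k, hk, hκ⟩
    rw [hκ]
    have h1 : κ k (Metric.closedBall (X ω j) r) ≤ min (φ (X ω)) 1 :=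
      le_min (le_successBound κ j r hk) prob_le_one
    have h2 : κ k (Metric.closedBall (X ω j) r)ᶜ
        ≤ (∫⁻ u, ENNReal.ofReal |X ω j - u| ∂(κ k)) / ENNReal.ofReal r := by
      refine le_trans (measure_mono fun u hu => ?_)
        (meas_ge_le_lintegral_div (by fun_prop) (by simpa using hr) ENNReal.ofReal_ne_top)
      rw [Set.mem_compl_iff, Metric.mem_closedBall, not_le, dist_comm, Real.dist_eq] at hu
      exact ENNReal.ofReal_le_ofReal hu.le
    calc (1 : ℝ≥0∞) = κ k (Metric.closedBall (X ω j) r) + κ k (Metric.closedBall (X ω j) r)ᶜ := by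
          rw [measure_add_measure_compl Metric.isClosed_closedBall.measurableSet, measure_univ]
      _ ≤ _ := add_le_add h1 h2
  have hline : ∫⁻ x in Metric.closedBall (0 : ι → ℝ) R, min (φ x) 1
      ≤ ENNReal.ofReal ((4 * C + 1) ^ Fintype.card n * (2 * (r / |d j|)))
          * volume (Metric.closedBall (0 : ι → ℝ) (R + D)) :=
    (lintegral_mono fun x => min_le_left _ _).trans
      (setLIntegral_closedBall_le_of_line hφm hdD
        (setLIntegral_successBound_line_le L hC κ r hLd hdj))
  calc (1 : ℝ≥0∞) = ∫⁻ _, 1 ∂P := by simp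
    _ ≤ ∫⁻ ω, (min (φ (X ω)) 1
          + (∫⁻ u, ENNReal.ofReal |X ω j - u| ∂(η ω)) / ENNReal.ofReal r) ∂P :=
        lintegral_mono_ae hmarkov
    _ = ∫⁻ x, min (φ x) 1 ∂(P.map X)
          + (∫⁻ ω, ∫⁻ u, ENNReal.ofReal |X ω j - u| ∂(η ω) ∂P) / ENNReal.ofReal r := by
        rw [lintegral_map hψm hX,
          lintegral_add_left (show Measurable fun ω => min (φ (X ω)) 1 from hψm.comp hX)]
        simp only [div_eq_mul_inv]
        rw [lintegral_mul_const' _ _ (by simpa using hr)]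
    _ ≤ _ := by
        gcongr
        refine (lintegral_le_of_lt_diffEntropy hΔ hball hsupp hψm
          (fun _ => min_le_right _ _) hT).trans ?_
        gcongr

/-- If a direction `d` with `|d j| ≥ c B^(-γ)` changes the exact answers by no more than their
precision, then the accuracy with which the coordinate `j` can be decoded is at most `B^(-γ)`. -/
theorem exponent_le_of_direction {Ω ι n : Type*} [MeasurableSpace Ω] {P : Measure Ω}
    [IsProbabilityMeasure P] [Fintype ι] [Fintype n]
    {X : ℕ → Ω → ι → ℝ} (hX : ∀ B, Measurable (X B)) {R : ℝ}
    (hR : ∀ᶠ B in atTop, ∀ᵐ ω ∂P, ‖X B ω‖ ≤ R) {Δ : ℝ}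
    (hΔ : ∀ᶠ B in atTop, (Δ : EReal) < diffEntropy (P.map (X B)))
    (L : ℕ → (ι → ℝ) →ₗ[ℝ] n → ℝ) {C : ℝ} (hC : 0 ≤ C) (κ : ℕ → (n → ℤ) → Measure ℝ)
    [∀ B k, IsProbabilityMeasure (κ B k)] {η : ℕ → Ω → Measure ℝ}
    (hη : ∀ᶠ B in atTop, ∀ᵐ ω ∂P, ∃ k : n → ℤ,
      (∀ i, |(k i : ℝ) - L B (X B ω) i| ≤ C) ∧ η B ω = κ B k)
    {j : ι} {E ν : ℝ} (hrec : ∀ᶠ B : ℕ in atTop,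
      ∫⁻ ω, ∫⁻ u, ENNReal.ofReal |X B ω j - u| ∂(η B ω) ∂P ≤ ENNReal.ofReal (E * (B : ℝ) ^ (-ν)))
    {d : ℕ → ι → ℝ} {D c γ : ℝ} (hc : 0 < c)
    (hd : ∀ᶠ B : ℕ in atTop,
      ‖d B‖ ≤ D ∧ (∀ i, |L B (d B) i| ≤ C) ∧ c * (B : ℝ) ^ (-γ) ≤ |d B j|) :
    ν ≤ γ := by
  by_contra! hlt
  set W : ℝ := (volume (Metric.closedBall (0 : ι → ℝ) R) + ENNReal.ofReal (-Δ)).toReal with hW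
  set V : ℝ := (volume (Metric.closedBall (0 : ι → ℝ) (R + D))).toReal with hV
  have hWtop : volume (Metric.closedBall (0 : ι → ℝ) R) + ENNReal.ofReal (-Δ) ≠ ⊤ :=
    ENNReal.add_ne_top.2 ⟨measure_closedBall_lt_top.ne, ENNReal.ofReal_ne_top⟩
  have hW0 : 0 ≤ W := ENNReal.toReal_nonneg
  have hV0 : 0 ≤ V := ENNReal.toReal_nonneg
  -- the threshold makes the entropy term at most `1 / 8`
  set T : ℝ := Real.exp (8 * W + 1) with hT
  have hT1 : 1 < T := Real.one_lt_exp_iff.2 (by linarith)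
  have hlogT : Real.log T = 8 * W + 1 := Real.log_exp _
  -- at radius `A B^(-ν)` the failure probability is at most `1 / 2`
  set A : ℝ := 2 * |E| + 1 with hA
  have hA0 : 0 < A := by positivity
  set Q : ℝ := T * ((4 * C + 1) ^ Fintype.card n * (2 * (A / c)) * V) with hQ
  have hlim : Tendsto (fun B : ℕ => Q * (B : ℝ) ^ (-(ν - γ))) atTop (nhds 0) := by
    have h := ((tendsto_rpow_neg_atTop (sub_pos.2 hlt)).comp
      tendsto_natCast_atTop_atTop).const_mul Q
    rwa [mul_zero] at h
  obtain ⟨B, hRB, hΔB, hηB, hrecB, ⟨hdD, hLd, hdj⟩, hsmall, hB1⟩ :=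
    (hR.and <| hΔ.and <| hη.and <| hrec.and <| hd.and <|
      (hlim.eventually (gt_mem_nhds (show (0 : ℝ) < 1 / 8 by norm_num))).and
        (eventually_ge_atTop 1)).exists
  have hB0 : (0 : ℝ) < B := by exact_mod_cast hB1
  have hpos : 0 < c * (B : ℝ) ^ (-γ) := by positivity
  have hdj0 : 0 < |d B j| := hpos.trans_le hdj
  set r : ℝ := A * (B : ℝ) ^ (-ν) with hr
  have hr0 : 0 < r := by positivity
  have h1 := one_le_of_line (hX B) hRB hΔB (L B) hC (κ B) hηB hdD hLd (abs_pos.1 hdj0) hr0 hT1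
  have hratio : r / |d B j| ≤ A / c * (B : ℝ) ^ (-(ν - γ)) := by
    rw [div_le_iff₀ hdj0]
    calc r = A / c * (B : ℝ) ^ (-(ν - γ)) * (c * (B : ℝ) ^ (-γ)) := by
          have h2 : (B : ℝ) ^ (-(ν - γ)) * (B : ℝ) ^ (-γ) = (B : ℝ) ^ (-ν) := by
            rw [← Real.rpow_add hB0]
            ring_nf
          rw [hr, ← h2]
          field_simp
      _ ≤ _ := mul_le_mul_of_nonneg_left hdj (by positivity)
  have hterm1 : ENNReal.ofReal T *
      (ENNReal.ofReal ((4 * C + 1) ^ Fintype.card n * (2 * (r / |d B j|)))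
          * volume (Metric.closedBall (0 : ι → ℝ) (R + D))) ≤ ENNReal.ofReal (1 / 8) := by
    rw [← ENNReal.ofReal_toReal (measure_closedBall_lt_top (μ := (volume : Measure (ι → ℝ)))).ne,
      ← ENNReal.ofReal_mul (by positivity), ← ENNReal.ofReal_mul (by positivity)]
    refine ENNReal.ofReal_le_ofReal (le_trans ?_ hsmall.le)
    calc T * ((4 * C + 1) ^ Fintype.card n * (2 * (r / |d B j|)) * V)
        ≤ T * ((4 * C + 1) ^ Fintype.card n * (2 * (A / c * (B : ℝ) ^ (-(ν - γ)))) * V) := by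
          gcongr
      _ = Q * (B : ℝ) ^ (-(ν - γ)) := by
          rw [hQ]
          ring
  have hterm2 : ENNReal.ofReal (1 / Real.log T) *
      (volume (Metric.closedBall (0 : ι → ℝ) R) + ENNReal.ofReal (-Δ))
        ≤ ENNReal.ofReal (1 / 8) := by
    rw [← ENNReal.ofReal_toReal hWtop, hlogT, ← ENNReal.ofReal_mul (by positivity)]
    refine ENNReal.ofReal_le_ofReal ?_
    rw [← hW, one_div_mul_eq_div, div_le_iff₀ (by positivity)]
    linarith
  have hterm3 : (∫⁻ ω, ∫⁻ u, ENNReal.ofReal |X B ω j - u| ∂(η B ω) ∂P) / ENNReal.ofReal r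
      ≤ ENNReal.ofReal (1 / 2) := by
    refine ENNReal.div_le_of_le_mul (hrecB.trans ?_)
    rw [← ENNReal.ofReal_mul (by norm_num)]
    refine ENNReal.ofReal_le_ofReal ?_
    rw [hr, ← mul_assoc]
    refine mul_le_mul_of_nonneg_right ?_ (by positivity)
    rw [hA]
    linarith [le_abs_self E]
  have h2 := h1.trans (add_le_add (add_le_add hterm1 hterm2) hterm3)
  rw [← ENNReal.ofReal_add (by norm_num) (by norm_num),
    ← ENNReal.ofReal_add (by norm_num) (by norm_num), ENNReal.one_le_ofReal] at h2
  norm_num at h2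

/-! ### Bounds for coefficients, shares and answers -/

theorem abs_coeff_prod_X_sub_C_le {n : Type*} (s : Finset n) (a : n → ℝ) {A : ℝ} (hA : 0 ≤ A)
    (ha : ∀ i, |a i| ≤ A) (k : ℕ) :
    |(∏ i ∈ s, (Polynomial.X - Polynomial.C (a i))).coeff k| ≤ (1 + A) ^ s.card := by
  classical
  induction s using Finset.induction_on generalizing k with
  | empty =>
    rw [Finset.prod_empty, Polynomial.coeff_one]
    split_ifs <;> simp
  | insert i s hi ih =>
    rw [Finset.prod_insert hi, Finset.card_insert_of_notMem hi, sub_mul, Polynomial.coeff_sub,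
      Polynomial.coeff_C_mul]
    have h1 : |(Polynomial.X * ∏ i ∈ s, (Polynomial.X - Polynomial.C (a i))).coeff k|
        ≤ (1 + A) ^ s.card := by
      cases k with
      | zero =>
        rw [Polynomial.coeff_X_mul_zero, abs_zero]
        positivity
      | succ k =>
        rw [Polynomial.coeff_X_mul]
        exact ih k
    have h2 := mul_le_mul (ha i) (ih k) (abs_nonneg _) hA
    rw [← abs_mul] at h2
    refine (abs_sub _ _).trans ?_
    rw [pow_succ]
    linarith

theorem abs_coeffX_le {p m : ℕ} {U V : Fin p → Fin m → ℝ} {C : ℝ}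
    (h : ∀ j k, |U j k| ≤ C ∧ |V j k| ≤ C) (k : ℕ) :
    |coeffX U V k| ≤ p * (p * (m * (C * C))) := by
  have hterm : ∀ a b : Fin p, |if (a : ℕ) + (p - 1 - (b : ℕ)) = k then U a ⬝ᵥ V b else 0|
      ≤ m * (C * C) := by
    intro a b
    have h1 : |U a ⬝ᵥ V b| ≤ m * (C * C) := by
      calc |U a ⬝ᵥ V b| ≤ ∑ i, |U a i * V b i| := Finset.abs_sum_le_sum_abs _ _
        _ ≤ ∑ _i : Fin m, C * C := Finset.sum_le_sum fun i _ => by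
            rw [abs_mul]
            exact mul_le_mul (h a i).1 (h b i).2 (abs_nonneg _) ((abs_nonneg _).trans (h a i).1)
        _ = m * (C * C) := by simp
    split_ifs
    · exact h1
    · rw [abs_zero]
      exact (abs_nonneg _).trans h1
  calc |coeffX U V k| ≤ ∑ a : Fin p, ∑ b : Fin p,
        |if (a : ℕ) + (p - 1 - (b : ℕ)) = k then U a ⬝ᵥ V b else 0| :=
        (Finset.abs_sum_le_sum_abs _ _).trans
          (Finset.sum_le_sum fun a _ => Finset.abs_sum_le_sum_abs _ _)
    _ ≤ ∑ _a : Fin p, ∑ _b : Fin p, m * (C * C) :=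
        Finset.sum_le_sum fun a _ => Finset.sum_le_sum fun b _ => hterm a b
    _ = p * (p * (m * (C * C))) := by simp

/-- A uniform bound for the entries of both shares, whose exponents are `e a = a` and
`e a = p - 1 - a`. -/
theorem abs_sum_pow_mul_le {p : ℕ} {α A C : ℝ} (hA : 1 ≤ A) (hα : |α| ≤ A) {e : Fin p → ℕ}
    (he : ∀ a, e a ≤ p) {x : Fin p → ℝ} (hx : ∀ a, |x a| ≤ C) :
    |∑ a, α ^ e a * x a| ≤ p * (A ^ p * C) := by
  calc |∑ a, α ^ e a * x a| ≤ ∑ a, |α ^ e a * x a| := Finset.abs_sum_le_sum_abs _ _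
    _ ≤ ∑ _a : Fin p, A ^ p * C := Finset.sum_le_sum fun a _ => by
        rw [abs_mul, abs_pow]
        refine mul_le_mul ?_ (hx a) (abs_nonneg _) (by positivity)
        exact (pow_le_pow_left₀ (abs_nonneg _) hα _).trans (pow_le_pow_right₀ hA (he a))
    _ = p * (A ^ p * C) := by simp

/-- The answer of a server, in units of its last digit, is an integer within `O(1)` of the scaled
exact product of the two shares. -/
theorem exists_int_near_of_isDigitRep {m : ℕ} {B μf μg νf νg νy : ℝ} (hB : 1 ≤ B) (hνy : 0 ≤ νy)
    (hνf : νy ≤ νf) (hνg : νy ≤ νg) {S Cf Cg Cy : ℝ}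
    {f g F G : Fin m → ℝ} (hf : ∀ k, |f k| ≤ S) (hg : ∀ k, |g k| ≤ S)
    (hF : ∀ k, IsDigitRep B μf νf Cf (f k) (F k)) (hG : ∀ k, IsDigitRep B μg νg Cg (g k) (G k))
    {Y : ℝ} (hY : IsDigitRep B (μf + μg) νy Cy ((F ⬝ᵥ G) / B ^ (μf + μg)) Y) :
    ∃ k : ℤ, Y = B ^ (μf + μg - νy) * k ∧
      |(k : ℝ) - B ^ νy * (f ⬝ᵥ g)| ≤ Cy + m * (S * Cg + Cf * S + Cf * Cg) := by
  have hB0 : 0 < B := by linarith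
  obtain ⟨⟨k, hk⟩, w, hw, hYw⟩ := hY
  refine ⟨k, hk, ?_⟩
  choose wf hwf hFw using fun k => (hF k).2
  choose wg hwg hGw using fun k => (hG k).2
  have hprod : (F ⬝ᵥ G) / B ^ (μf + μg)
      = ∑ k, (f k + B ^ (-νf) * wf k) * (g k + B ^ (-νg) * wg k) := by
    rw [div_eq_iff (by positivity), Finset.sum_mul]
    refine Finset.sum_congr rfl fun k _ => ?_
    rw [hFw, hGw, Real.rpow_add hB0]
    ring
  have hkw : (k : ℝ) = B ^ νy * ((F ⬝ᵥ G) / B ^ (μf + μg)) + w := by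
    have h1 : B ^ (μf + μg) = B ^ (μf + μg - νy) * B ^ νy := by
      rw [← Real.rpow_add hB0]
      ring_nf
    have h2 : B ^ νy * B ^ (-νy) = 1 := by rw [← Real.rpow_add hB0]; simp
    have h3 : B ^ (μf + μg - νy) * (k : ℝ)
        = B ^ (μf + μg - νy) * (B ^ νy * ((F ⬝ᵥ G) / B ^ (μf + μg)) + w) := by
      rw [← hk, hYw]
      nth_rewrite 1 [h1]
      linear_combination (B ^ (μf + μg - νy) * w) * h2
    exact mul_left_cancel₀ (by positivity) h3
  have herr : ∀ k, |B ^ νy * ((f k + B ^ (-νf) * wf k) * (g k + B ^ (-νg) * wg k) - f k * g k)|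
      ≤ S * Cg + Cf * S + Cf * Cg := by
    intro k
    have e1 : B ^ νy * B ^ (-νf) ≤ 1 := by
      rw [← Real.rpow_add hB0]
      exact Real.rpow_le_one_of_one_le_of_nonpos hB (by linarith)
    have e2 : B ^ νy * B ^ (-νg) ≤ 1 := by
      rw [← Real.rpow_add hB0]
      exact Real.rpow_le_one_of_one_le_of_nonpos hB (by linarith)
    have e3 : B ^ (-νg) ≤ 1 := Real.rpow_le_one_of_one_le_of_nonpos hB (by linarith)
    have e4 : (B ^ νy * B ^ (-νf)) * B ^ (-νg) ≤ 1 :=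
      mul_le_one₀ e1 (by positivity) e3
    have hterm : ∀ {ε x y a b : ℝ}, 0 ≤ ε → ε ≤ 1 → |x| ≤ a → |y| ≤ b →
        |ε * (x * y)| ≤ a * b := by
      intro ε x y a b h0 h1 hx hy
      rw [abs_mul, abs_mul, abs_of_nonneg h0]
      exact (mul_le_of_le_one_left (by positivity) h1).trans
        (mul_le_mul hx hy (abs_nonneg _) ((abs_nonneg _).trans hx))
    have hsplit : B ^ νy * ((f k + B ^ (-νf) * wf k) * (g k + B ^ (-νg) * wg k) - f k * g k)
        = (B ^ νy * B ^ (-νg)) * (f k * wg k) + (B ^ νy * B ^ (-νf)) * (wf k * g k)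
          + ((B ^ νy * B ^ (-νf)) * B ^ (-νg)) * (wf k * wg k) := by ring
    rw [hsplit]
    exact (abs_add_three _ _ _).trans (add_le_add (add_le_add
      (hterm (by positivity) e2 (hf k) (hwg k)) (hterm (by positivity) e1 (hwf k) (hg k)))
      (hterm (by positivity) e4 (hwf k) (hwg k)))
  have hdiff : (k : ℝ) - B ^ νy * (f ⬝ᵥ g) = w +
      ∑ k, B ^ νy * ((f k + B ^ (-νf) * wf k) * (g k + B ^ (-νg) * wg k) - f k * g k) := by
    rw [hkw, hprod, ← Finset.mul_sum, Finset.sum_sub_distrib]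
    simp only [dotProduct]
    ring
  rw [hdiff]
  refine (abs_add_le _ _).trans (add_le_add hw ?_)
  calc _ ≤ ∑ k, |B ^ νy * ((f k + B ^ (-νf) * wf k) * (g k + B ^ (-νg) * wg k) - f k * g k)| :=
        Finset.abs_sum_le_sum_abs _ _
    _ ≤ ∑ _k : Fin m, (S * Cg + Cf * S + Cf * Cg) := Finset.sum_le_sum fun k _ => herr k
    _ = m * (S * Cg + Cf * S + Cf * Cg) := by
        rw [Finset.sum_const, Finset.card_univ, Fintype.card_fin, nsmul_eq_mul]

/-! ### The two directions of the approximate MatDot code -/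

theorem sum_univ_subtype_eq_sum_range {N : ℕ} (f : ℕ → ℝ) :
    ∑ k : (Finset.univ : Finset (Fin N)), f (k : Fin N) = ∑ k ∈ Finset.range N, f k := by
  rw [Finset.sum_coe_sort Finset.univ fun k : Fin N => f k, Fin.sum_univ_eq_sum_range]

/-- The map from the coefficients `x_0, …, x_{N-1}` to the values `s ∑ k, x_k α_iᵏ` at the
evaluation points, in the scale `s`. The index type of the coefficients is the coercion of
`Finset.univ`, which is the one that occurs in the entropy of the full family. -/
noncomputable def evalMap {p : ℕ} (N : ℕ) (s : ℝ) (α : Fin p → ℝ) :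
    (↥(Finset.univ : Finset (Fin N)) → ℝ) →ₗ[ℝ] Fin p → ℝ :=
  Matrix.mulVecLin (Matrix.of fun i k => s * α i ^ ((k : Fin N) : ℕ))

theorem evalMap_apply {p N : ℕ} (s : ℝ) (α : Fin p → ℝ) (x : ℕ → ℝ) (i : Fin p) :
    evalMap N s α (fun k => x (k : Fin N)) i = s * ∑ k ∈ Finset.range N, x k * α i ^ k := by
  rw [Finset.mul_sum, ← sum_univ_subtype_eq_sum_range]
  simp only [evalMap, Matrix.mulVecLin_apply, Matrix.mulVec, dotProduct, Matrix.of_apply]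
  exact Finset.sum_congr rfl fun k _ => by ring

theorem evalMap_coeff_eq_zero {p N : ℕ} (hN : p < N) (s : ℝ) (α : Fin p → ℝ) (i : Fin p) :
    evalMap N s α (fun k =>
      (∏ l, (Polynomial.X - Polynomial.C (α l))).coeff ((k : Fin N) : ℕ)) i = 0 := by
  have hdeg : (∏ l, (Polynomial.X - Polynomial.C (α l))).natDegree < N := by
    rwa [Polynomial.natDegree_finsetProd_X_sub_C_eq_card, Finset.card_univ, Fintype.card_fin]
  refine (evalMap_apply s α
    (fun k => (∏ l, (Polynomial.X - Polynomial.C (α l))).coeff k) i).trans ?_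
  rw [← Polynomial.eval_eq_sum_range' hdeg, Polynomial.eval_prod,
    Finset.prod_eq_zero (Finset.mem_univ i) (by simp), mul_zero]

theorem measurable_coeffX {Ω : Type*} [MeasurableSpace Ω] {p m : ℕ} {U V : Ω → Fin p → Fin m → ℝ}
    (hU : Measurable U) (hV : Measurable V) (k : ℕ) :
    Measurable fun ω => coeffX (U ω) (V ω) k := by
  unfold coeffX
  refine Finset.measurable_sum _ fun a _ => Finset.measurable_sum _ fun b _ => ?_
  split_ifs
  · simp only [dotProduct]
    fun_prop
  · exact measurable_const

/-- The converse bound on the accuracy, in terms of the law of the coefficients alone. The direction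
`B^(-γ) e_{p-1}` gives the bound `γ = (νy - (p-1) δ)⁺`, and the direction formed by the coefficients
of `∏ l, (X - α_l)`, in the kernel of the evaluations, gives the bound `δ`. -/
theorem exponent_le_min {Ω : Type*} [MeasurableSpace Ω] (P : Measure Ω) [IsProbabilityMeasure P]
    {p : ℕ} (hp : 2 ≤ p) {δ νy ν : ℝ} (hδ : 0 < δ)
    {abar α : ℕ → Fin p → ℝ} (hα : ∀ B i, α B i = (B : ℝ) ^ (-δ) * abar B i)
    {A : ℝ} (hA : 1 ≤ A) (habar : ∀ᶠ B in atTop, ∀ i, |abar B i| ≤ A)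
    {c : ℝ} (hc : 0 < c) (hsum : ∀ᶠ B in atTop, c ≤ |∑ i, abar B i|)
    {X : ℕ → Ω → ↥(Finset.univ : Finset (Fin (2 * p - 1))) → ℝ} (hX : ∀ B, Measurable (X B)) {R : ℝ}
    (hR : ∀ᶠ B in atTop, ∀ᵐ ω ∂P, ‖X B ω‖ ≤ R) {Δ : ℝ}
    (hΔ : ∀ᶠ B in atTop, (Δ : EReal) < diffEntropy (P.map (X B)))
    (κ : ℕ → (Fin p → ℤ) → Measure ℝ)
    [∀ B k, IsProbabilityMeasure (κ B k)] {η : ℕ → Ω → Measure ℝ} {C : ℝ}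
    (hη : ∀ᶠ B : ℕ in atTop, ∀ᵐ ω ∂P, ∃ k : Fin p → ℤ,
      (∀ i, |(k i : ℝ) - evalMap (2 * p - 1) ((B : ℝ) ^ νy) (α B) (X B ω) i| ≤ C) ∧ η B ω = κ B k)
    {j : (Finset.univ : Finset (Fin (2 * p - 1)))} (hj : ((j : Fin (2 * p - 1)) : ℕ) = p - 1)
    {E : ℝ} (hrec : ∀ᶠ B : ℕ in atTop,
      ∫⁻ ω, ∫⁻ u, ENNReal.ofReal |X B ω j - u| ∂(η B ω) ∂P
        ≤ ENNReal.ofReal (E * (B : ℝ) ^ (-ν))) :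
    ν ≤ min δ (max (νy - (p - 1) * δ) 0) := by
  set C' : ℝ := max C (A ^ (p - 1)) with hC'
  have hC'0 : 0 ≤ C' := le_max_of_le_right (by positivity)
  have hη' : ∀ᶠ B : ℕ in atTop, ∀ᵐ ω ∂P, ∃ k : Fin p → ℤ,
      (∀ i, |(k i : ℝ) - evalMap (2 * p - 1) ((B : ℝ) ^ νy) (α B) (X B ω) i| ≤ C') ∧
        η B ω = κ B k := by
    filter_upwards [hη] with B hB
    filter_upwards [hB] with ω ⟨k, hk, hκ⟩
    exact ⟨k, fun i => (hk i).trans (le_max_left _ _), hκ⟩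
  refine le_min ?_ ?_
  · -- along the coefficients of `∏ l, (X - α_l)` the evaluations do not change at all
    refine exponent_le_of_direction hX hR hΔ
      (fun B : ℕ => evalMap (2 * p - 1) ((B : ℝ) ^ νy) (α B)) hC'0 κ hη' hrec
      (d := fun B k => (∏ l, (Polynomial.X - Polynomial.C (α B l))).coeff
        ((k : Fin (2 * p - 1)) : ℕ)) (D := (1 + A) ^ p) hc ?_
    filter_upwards [habar, hsum, eventually_ge_atTop 1] with B hB hsB hB1
    have hB1' : (1 : ℝ) ≤ B := by exact_mod_cast hB1
    have hB0 : (0 : ℝ) < B := by linarith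
    have hαB : ∀ i, |α B i| ≤ A := by
      intro i
      rw [hα, abs_mul, abs_of_pos (by positivity)]
      exact (mul_le_of_le_one_left (abs_nonneg _)
        (Real.rpow_le_one_of_one_le_of_nonpos hB1' (by linarith))).trans (hB i)
    refine ⟨?_, fun i => ?_, ?_⟩
    · refine (pi_norm_le_iff_of_nonneg (by positivity)).2 fun k => ?_
      have h := abs_coeff_prod_X_sub_C_le Finset.univ (α B) (by linarith) hαB
        ((k : Fin (2 * p - 1)) : ℕ)
      rwa [Finset.card_univ, Fintype.card_fin] at h
    · rw [evalMap_coeff_eq_zero (by omega), abs_zero]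
      exact hC'0
    · have hcard : (Finset.univ : Finset (Fin p)).card = p := by simp
      have hcoeff : (∏ l, (Polynomial.X - Polynomial.C (α B l))).coeff (p - 1)
          = -∑ l, α B l := by
        have h := Polynomial.prod_X_sub_C_coeff_card_pred Finset.univ (α B) (by omega)
        rwa [hcard] at h
      -- the coordinate `p - 1` of this direction is `-∑ l, α_l`, of size at least `c B^(-δ)`
      simp only [hj]
      rw [hcoeff, abs_neg]
      simp only [hα]
      rw [← Finset.mul_sum, abs_mul, abs_of_pos (by positivity : (0 : ℝ) < (B : ℝ) ^ (-δ)),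
        mul_comm]
      gcongr
  · -- a change of `x_{p-1}` by `B^(-γ)` stays below the precision of the answers
    set γ : ℝ := max (νy - (p - 1) * δ) 0 with hγ
    refine exponent_le_of_direction hX hR hΔ
      (fun B : ℕ => evalMap (2 * p - 1) ((B : ℝ) ^ νy) (α B)) hC'0 κ hη' hrec
      (d := fun B k => if ((k : Fin (2 * p - 1)) : ℕ) = p - 1 then (B : ℝ) ^ (-γ) else 0)
      (D := 1) one_pos ?_
    filter_upwards [habar, eventually_ge_atTop 1] with B hB hB1
    have hB1' : (1 : ℝ) ≤ B := by exact_mod_cast hB1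
    have hB0 : (0 : ℝ) < B := by linarith
    refine ⟨?_, fun i => ?_, ?_⟩
    · refine (pi_norm_le_iff_of_nonneg (by positivity)).2 fun k => ?_
      split_ifs
      · rw [Real.norm_eq_abs, abs_of_pos (by positivity)]
        exact Real.rpow_le_one_of_one_le_of_nonpos hB1' (by
          rw [neg_nonpos]
          exact le_max_right _ _)
      · simp
    · rw [evalMap_apply _ _ (fun k => if k = p - 1 then (B : ℝ) ^ (-γ) else 0),
        Finset.sum_eq_single_of_mem (p - 1) (Finset.mem_range.2 (by omega))
          (fun k _ hk => by rw [if_neg hk, zero_mul]), if_pos rfl, hα, mul_pow]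
      have hpow : ((B : ℝ) ^ (-δ)) ^ (p - 1) = (B : ℝ) ^ (-((p - 1) * δ)) := by
        rw [← Real.rpow_natCast, ← Real.rpow_mul hB0.le, Nat.cast_sub (by omega)]
        congr 1
        push_cast
        ring
      rw [hpow, ← mul_assoc, ← mul_assoc, ← Real.rpow_add hB0, ← Real.rpow_add hB0, abs_mul,
        abs_of_pos (by positivity), abs_pow]
      refine (mul_le_of_le_one_left (by positivity) ?_).trans
        ((pow_le_pow_left₀ (abs_nonneg _) (hB i) _).trans (le_max_right _ _))
      refine Real.rpow_le_one_of_one_le_of_nonpos hB1' ?_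
      linarith [le_max_left (νy - (p - 1) * δ) 0]
    · rw [if_pos hj, one_mul]
      exact le_abs_self _

end AMD

theorem mainTheorem1
    {Ω : Type*} [MeasurableSpace Ω] (P : Measure Ω) [IsProbabilityMeasure P]
    -- number `p` of blocks and of answers, length `m` of a block
    (p m : ℕ) (hp : 2 ≤ p)
    -- exponents: evaluation points, scales, precision of uploads, downloads and recovered value
    (δ μf μg νf νg νy ν : ℝ) (hδ : 0 < δ) (hνy : 0 ≤ νy) (hνyfg : νy ≤ min νf νg)
    -- evaluation points `α_i = B^(-δ) ᾱ_i`
    (abar α : ℕ → Fin p → ℝ) (hα : ∀ B i, α B i = (B : ℝ) ^ (-δ) * abar B i)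
    (habar : AMD.IsThetaOne abar) (hgen : AMD.IsGeneric abar)
    -- normalized inputs, bounded uniformly in the base `B`
    (U V : ℕ → Ω → Fin p → Fin m → ℝ)
    (hU : ∀ B, Measurable (U B)) (hV : ∀ B, Measurable (V B))
    (hbdd : ∃ C : ℝ, ∀ᶠ B : ℕ in atTop, ∀ᵐ ω ∂P, ∀ j k, |U B ω j k| ≤ C ∧ |V B ω j k| ≤ C)
    -- the coefficients `X_0, …, X_{2p-2}` are independent, with entropies bounded below
    (hindep : ∀ᶠ B : ℕ in atTop,
      iIndepFun (fun (k : Fin (2 * p - 1)) ω => AMD.coeffX (U B ω) (V B ω) k) P)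
    (hentropy : ∃ Δ : ℝ, ∀ᶠ B : ℕ in atTop, ∀ S : Finset (Fin (2 * p - 1)), S.Nonempty →
      (Δ : EReal) <
        AMD.diffEntropy (P.map fun ω (k : S) => AMD.coeffX (U B ω) (V B ω) (k : Fin (2 * p - 1))))
    -- uploads to server `i`, of precision `νf` and `νg`
    (F G : ℕ → Ω → Fin p → Fin m → ℝ)
    (hF : ∃ C : ℝ, ∀ᶠ B : ℕ in atTop, ∀ᵐ ω ∂P, ∀ i k,
      AMD.IsDigitRep B μf νf C (AMD.shareF (α B i) (U B ω) k) (F B ω i k))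
    (hG : ∃ C : ℝ, ∀ᶠ B : ℕ in atTop, ∀ᵐ ω ∂P, ∀ i k,
      AMD.IsDigitRep B μg νg C (AMD.shareG (α B i) (V B ω) k) (G B ω i k))
    -- download from server `i`: its product `F_i G_i`, to precision `νy`
    (Y : ℕ → Ω → Fin p → ℝ) (hY : ∀ B, Measurable (Y B))
    (hYrep : ∃ C : ℝ, ∀ᶠ B : ℕ in atTop, ∀ᵐ ω ∂P, ∀ i,
      AMD.IsDigitRep B (μf + μg) νy C
        ((F B ω i ⬝ᵥ G B ω i) / (B : ℝ) ^ (μf + μg)) (Y B ω i))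
    -- a (possibly randomized) decoding rule, applied to the `p` answers, recovers the product `U V`
    -- with mean absolute error `O(B^(-ν))`
    (dec : ℕ → Kernel (Fin p → ℝ) ℝ) (hdec : ∀ B, IsMarkovKernel (dec B))
    (hrec : ∃ C : ℝ, ∀ᶠ B : ℕ in atTop,
      ∫⁻ ω, ∫⁻ u, ENNReal.ofReal |AMD.product (U B ω) (V B ω) - u| ∂(dec B (Y B ω)) ∂P
        ≤ ENNReal.ofReal (C * (B : ℝ) ^ (-ν))) :
    ν ≤ min δ (max (νy - (p - 1) * δ) 0) ∧ p * ν ≤ min νf νg := by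
  obtain ⟨a, A₀, -, hA₀⟩ := habar
  obtain ⟨c, hc, hgen⟩ := hgen
  obtain ⟨Cb, hCb⟩ := hbdd
  obtain ⟨Δ, hΔ⟩ := hentropy
  obtain ⟨Cf, hCf⟩ := hF
  obtain ⟨Cg, hCg⟩ := hG
  obtain ⟨Cy, hCy⟩ := hYrep
  obtain ⟨E, hE⟩ := hrec
  set A : ℝ := max A₀ 1 with hA
  set S : ℝ := p * (A ^ p * Cb) with hS
  have hA1 : 1 ≤ A := le_max_right _ _
  have hνyf : νy ≤ νf := hνyfg.trans (min_le_left _ _)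
  have hνyg : νy ≤ νg := hνyfg.trans (min_le_right _ _)
  have hfirst : ν ≤ min δ (max (νy - (p - 1) * δ) 0) := by
    have hAbar : ∀ᶠ B in atTop, ∀ i, |abar B i| ≤ A := by
      filter_upwards [hA₀] with B hB i
      exact (hB i).2.trans (le_max_left _ _)
    refine AMD.exponent_le_min P hp hδ hα hA1 hAbar hc (hgen.mono fun B hB => hB.2)
      (X := fun B ω k => AMD.coeffX (U B ω) (V B ω) (k : Fin (2 * p - 1)))
      (fun B => measurable_pi_lambda _ fun k => AMD.measurable_coeffX (hU B) (hV B) _)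
      (R := |p * (p * (m * (Cb * Cb)))|) ?_
      (hΔ.mono fun B hB => hB Finset.univ ⟨⟨0, by omega⟩, Finset.mem_univ _⟩)
      (fun B k => dec B fun i => (B : ℝ) ^ (μf + μg - νy) * (k i : ℝ))
      (η := fun B ω => dec B (Y B ω))
      (C := Cy + m * (S * Cg + Cf * S + Cf * Cg)) ?_
      (j := ⟨⟨p - 1, by omega⟩, Finset.mem_univ _⟩) rfl (E := E) ?_
    · filter_upwards [hCb] with B hB
      filter_upwards [hB] with ω hω
      refine (pi_norm_le_iff_of_nonneg (abs_nonneg _)).2 fun k => ?_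
      exact (AMD.abs_coeffX_le hω _).trans (le_abs_self _)
    · filter_upwards [hAbar, hCb, hCf, hCg, hCy, eventually_ge_atTop 1]
        with B hAB hbB hfB hgB hyB hB1
      have hB1' : (1 : ℝ) ≤ B := by exact_mod_cast hB1
      have hB0 : (0 : ℝ) < B := by linarith
      filter_upwards [hbB, hfB, hgB, hyB] with ω hbω hfω hgω hyω
      have hαB : ∀ i, |α B i| ≤ A := by
        intro i
        rw [hα, abs_mul, abs_of_pos (by positivity)]
        exact (mul_le_of_le_one_left (abs_nonneg _)
          (Real.rpow_le_one_of_one_le_of_nonpos hB1' (by linarith))).trans (hAB i)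
      have hf : ∀ i k, |AMD.shareF (α B i) (U B ω) k| ≤ S := by
        intro i k
        simp only [AMD.shareF, Finset.sum_apply, Pi.smul_apply, smul_eq_mul]
        exact AMD.abs_sum_pow_mul_le hA1 (hαB i) (fun a => a.isLt.le) fun a => (hbω a k).1
      have hg : ∀ i k, |AMD.shareG (α B i) (V B ω) k| ≤ S := by
        intro i k
        simp only [AMD.shareG, Finset.sum_apply, Pi.smul_apply, smul_eq_mul]
        exact AMD.abs_sum_pow_mul_le hA1 (hαB i) (fun a => by omega) fun a => (hbω a k).2
      choose k hk hk' using fun i => AMD.exists_int_near_of_isDigitRep hB1' hνy hνyf hνyg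
        (hf i) (hg i) (hfω i) (hgω i) (hyω i)
      refine ⟨k, fun i => ?_, ?_⟩
      · rw [AMD.evalMap_apply _ _ (AMD.coeffX (U B ω) (V B ω)), ← AMD.shareF_dotProduct_shareG]
        exact hk' i
      · exact congrArg (dec B) (funext hk)
    · simp only [AMD.coeffX_middle]
      exact hE
  refine ⟨hfirst, ?_⟩
  have hp' : (2 : ℝ) ≤ p := by exact_mod_cast hp
  rcases le_or_gt ν 0 with hν | hν
  · exact (mul_nonpos_of_nonneg_of_nonpos (by linarith) hν).trans (hνy.trans hνyfg)
  · -- for `ν > 0` the second bound reads `ν + (p - 1) δ ≤ νy`, and `ν ≤ δ`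
    have h1 : ν ≤ δ := hfirst.trans (min_le_left _ _)
    have h2 : ν ≤ νy - (p - 1) * δ :=
      (le_max_iff.1 (hfirst.trans (min_le_right _ _))).resolve_right (by linarith)
    have h3 : (p - 1 : ℝ) * ν ≤ (p - 1) * δ := mul_le_mul_of_nonneg_left h1 (by linarith)
    linarith
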